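/- Let $V$ be a finite-dimensional complex vector space and let $V^*$ be its linear dual. Let $\Lambda_2(V) \subseteq V \otimes V$ be the space of antisymmetric tensors and $S_2(V^*) \subseteq V^* \otimes V^*$ the space of symmetric tensors. Let $GL(V)$ act on $V$ in the natural way and on $V^*$ by the contragredient action, and consider the induced actions on $\Lambda_2(V)$, on $S_2(V^*)$, on their direct sum $\Lambda_2(V) \oplus S_2(V^*)$, and (by algebra automorphisms) on the exterior algebra $\Lambda(\Lambda_2(V) \oplus S_2(V^*))$. Then the only $GL(V)$-invariants in this exterior algebra are the scalars: $$\Lambda\bigl(\Lambda_2(V) \oplus S_2(V^*)\bigr)^{GL(V)} = \mathbb{C}\cdot 1 .$$ -/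

import Mathlib

open scoped TensorProduct

noncomputable section

/-- The natural representation of `GL(V)` on the complex vector space `V`. -/
def stdRep (V : Type*) [AddCommGroup V] [Module ℂ V] :
    Representation ℂ (LinearMap.GeneralLinearGroup ℂ V) V :=
  Units.coeHom (V →ₗ[ℂ] V)

section TensorSquare

variable {G : Type*} [Group G] {W : Type*} [AddCommGroup W] [Module ℂ W]

/-- `Λ₂(W)`, the space of antisymmetric tensors in `W ⊗ W`: the tensors whose sign changes when
the two factors are swapped. -/
def antisymTensors (W : Type*) [AddCommGroup W] [Module ℂ W] : Submodule ℂ (W ⊗[ℂ] W) where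
  carrier := {t | TensorProduct.comm ℂ W W t = -t}
  zero_mem' := by simp
  add_mem' {s t} hs ht := by
    simp only [Set.mem_ofPred_eq] at *
    rw [map_add, hs, ht, neg_add]
  smul_mem' c t ht := by
    simp only [Set.mem_ofPred_eq] at *
    rw [map_smul, ht, smul_neg]

/-- `S₂(W)`, the space of symmetric tensors in `W ⊗ W`: the tensors that do not change when the two
factors are swapped. -/
def symTensors (W : Type*) [AddCommGroup W] [Module ℂ W] : Submodule ℂ (W ⊗[ℂ] W) where
  carrier := {t | TensorProduct.comm ℂ W W t = t}
  zero_mem' := by simp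
  add_mem' {s t} hs ht := by
    simp only [Set.mem_ofPred_eq] at *
    rw [map_add, hs, ht]
  smul_mem' c t ht := by
    simp only [Set.mem_ofPred_eq] at *
    rw [map_smul, ht]

theorem comm_tprod_apply (ρ : Representation ℂ G W) (g : G) (t : W ⊗[ℂ] W) :
    TensorProduct.comm ℂ W W (ρ.tprod ρ g t) = ρ.tprod ρ g (TensorProduct.comm ℂ W W t) := by
  induction t with
  | zero => simp
  | add x y hx hy => simp only [map_add, hx, hy]
  | tmul x y => simp

/-- The representation on `Λ₂(W)` obtained by restricting `ρ ⊗ ρ`. -/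
def antisymRep (ρ : Representation ℂ G W) : Representation ℂ G (antisymTensors W) :=
  (ρ.tprod ρ).subrepresentation (antisymTensors W) fun g t ht => by
    change TensorProduct.comm ℂ W W (ρ.tprod ρ g t) = -(ρ.tprod ρ g t)
    rw [comm_tprod_apply, show TensorProduct.comm ℂ W W t = -t from ht, map_neg]

/-- The representation on `S₂(W)` obtained by restricting `ρ ⊗ ρ`. -/
def symRep (ρ : Representation ℂ G W) : Representation ℂ G (symTensors W) :=
  (ρ.tprod ρ).subrepresentation (symTensors W) fun g t ht => by
    change TensorProduct.comm ℂ W W (ρ.tprod ρ g t) = ρ.tprod ρ g t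
    rw [comm_tprod_apply, show TensorProduct.comm ℂ W W t = t from ht]

/-- The action of `G` by algebra endomorphisms on the exterior algebra `Λ(W)` induced by a
representation on `W`: `g · (w₁ ∧ ⋯ ∧ wₖ) = (g w₁) ∧ ⋯ ∧ (g wₖ)`. -/
def exteriorAction (ρ : Representation ℂ G W) :
    G →* (ExteriorAlgebra ℂ W →ₐ[ℂ] ExteriorAlgebra ℂ W) where
  toFun g := ExteriorAlgebra.map (ρ g)
  map_one' := by
    rw [map_one]
    exact ExteriorAlgebra.map_id
  map_mul' g h := by
    rw [map_mul]
    exact (ExteriorAlgebra.map_comp_map (ρ h) (ρ g)).symm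

/-- The algebra `Λ(W)^G` of invariants in the exterior algebra. -/
def exteriorInvariants (ρ : Representation ℂ G W) : Subalgebra ℂ (ExteriorAlgebra ℂ W) where
  carrier := {x | ∀ g : G, exteriorAction ρ g x = x}
  mul_mem' {x y} hx hy g := by rw [map_mul, hx g, hy g]
  add_mem' {x y} hx hy g := by rw [map_add, hx g, hy g]
  algebraMap_mem' c g := AlgHom.commutes _ c

end TensorSquare

/-- The natural representation of `GL(V)` on `Λ₂(V) ⊕ S₂(V*)`, where `GL(V)` acts on the linear
dual `V*` by the contragredient representation. -/
def antisymSymDualRep (V : Type*) [AddCommGroup V] [Module ℂ V] :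
    Representation ℂ (LinearMap.GeneralLinearGroup ℂ V)
      (antisymTensors V × symTensors (Module.Dual ℂ V)) :=
  (antisymRep (stdRep V)).prod (symRep (stdRep V).dual)

end

/-! Pass to the Lie algebra and compare Casimir operators. Let n = dim V, and let A and B be the
derivations of the exterior algebra that count the degree in `Λ₂(V)` and in `S₂(V*)`. The matrix
units E_ij act by commuting derivations α_ij and β_ij coming from the two summands, and an invariant
x satisfies α_ij x = -β_ij x.

A sum Σ α_ij α_ji is normally a second-order operator. Since Σ E_ij ⊗ E_ji is the flip on V ⊗ V, its
second-order part cancels against the anticommutativity of the exterior algebra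
(`sum_tensorLeibniz_mul_tensorLeibniz`). Hence it is a derivation, namely (2n - 2)A, and likewise Σ
β_ij β_ji = (2n + 2)B (`casimir`).

On an invariant the two sums agree, so (2n - 2)Ax = (2n + 2)Bx. The identity of gl(V) gives Ax = Bx.
Therefore 4Bx = 0, the total degree A + B kills x, and x is a scalar. -/

/-! ### Derivations of the exterior algebra -/

noncomputable section ExteriorDerivation

variable {W : Type*} [AddCommGroup W] [Module ℂ W]

/-- The derivation of the exterior algebra `Λ(W)` that extends an endomorphism of `W`. -/
def exteriorDerivation (f : W →ₗ[ℂ] W) : ExteriorAlgebra ℂ W →ₗ[ℂ] ExteriorAlgebra ℂ W :=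
  CliffordAlgebra.foldr' (0 : QuadraticForm ℂ W)
    (((LinearMap.mul ℂ (ExteriorAlgebra ℂ W)).compl₁₂ (ExteriorAlgebra.ι ℂ ∘ₗ f)
        (LinearMap.fst ℂ (ExteriorAlgebra ℂ W) (ExteriorAlgebra ℂ W))) +
      ((LinearMap.mul ℂ (ExteriorAlgebra ℂ W)).compl₁₂ (ExteriorAlgebra.ι ℂ)
        (LinearMap.snd ℂ (ExteriorAlgebra ℂ W) (ExteriorAlgebra ℂ W))))
    (fun m x fx => by
      -- The fold carries the pair (x, Dx). It is well defined because D respects m ∧ m = 0, that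
      -- is, f m ∧ m + m ∧ f m = 0.
      change ExteriorAlgebra.ι ℂ (f m) * (ExteriorAlgebra.ι ℂ m * x) +
        ExteriorAlgebra.ι ℂ m * (ExteriorAlgebra.ι ℂ (f m) * x + ExteriorAlgebra.ι ℂ m * fx) =
          (0 : ℂ) • fx
      have h1 := ExteriorAlgebra.ι_add_mul_swap (R := ℂ) (f m) m
      have h2 := ExteriorAlgebra.ι_sq_zero (R := ℂ) m
      rw [mul_add, ← mul_assoc, ← mul_assoc, ← mul_assoc, h2, zero_mul, add_zero, ← add_mul, h1,
        zero_mul, zero_smul])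
    0

theorem ExteriorAlgebra.left_induction {P : ExteriorAlgebra ℂ W → Prop}
    (algebraMap : ∀ c : ℂ, P (algebraMap ℂ _ c)) (add : ∀ x y, P x → P y → P (x + y))
    (ι_mul : ∀ x w, P x → P (ExteriorAlgebra.ι ℂ w * x)) (x : ExteriorAlgebra ℂ W) : P x :=
  CliffordAlgebra.left_induction (Q := (0 : QuadraticForm ℂ W)) algebraMap add ι_mul x

@[simp]
theorem exteriorDerivation_algebraMap (f : W →ₗ[ℂ] W) (c : ℂ) :
    exteriorDerivation f (algebraMap ℂ _ c) = 0 :=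
  (CliffordAlgebra.foldr'_algebraMap (Q := (0 : QuadraticForm ℂ W)) _ _ _ c).trans (smul_zero c)

@[simp]
theorem exteriorDerivation_ι_mul (f : W →ₗ[ℂ] W) (w : W) (x : ExteriorAlgebra ℂ W) :
    exteriorDerivation f (ExteriorAlgebra.ι ℂ w * x) =
      ExteriorAlgebra.ι ℂ (f w) * x + ExteriorAlgebra.ι ℂ w * exteriorDerivation f x :=
  CliffordAlgebra.foldr'_ι_mul (Q := (0 : QuadraticForm ℂ W)) _ _ _ w x

theorem exteriorDerivation_add (f g : W →ₗ[ℂ] W) :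
    exteriorDerivation (f + g) = exteriorDerivation f + exteriorDerivation g := by
  refine LinearMap.ext fun x => ?_
  induction x using ExteriorAlgebra.left_induction with
  | algebraMap c => simp
  | add x y hx hy => simp only [map_add, hx, hy]
  | ι_mul x w h =>
    simp only [exteriorDerivation_ι_mul, h, LinearMap.add_apply, map_add, add_mul, mul_add]
    abel

theorem exteriorDerivation_smul (c : ℂ) (f : W →ₗ[ℂ] W) :
    exteriorDerivation (c • f) = c • exteriorDerivation f := by
  refine LinearMap.ext fun x => ?_
  induction x using ExteriorAlgebra.left_induction with
  | algebraMap c => simp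
  | add x y hx hy => simp only [map_add, hx, hy]
  | ι_mul x w h => simp [h]

theorem exteriorDerivation_comm {f g : W →ₗ[ℂ] W} (h : ∀ w, f (g w) = g (f w))
    (x : ExteriorAlgebra ℂ W) :
    exteriorDerivation f (exteriorDerivation g x) =
      exteriorDerivation g (exteriorDerivation f x) := by
  induction x using ExteriorAlgebra.left_induction with
  | algebraMap c => simp
  | add x y hx hy => simp only [map_add, hx, hy]
  | ι_mul x w hx =>
    simp only [exteriorDerivation_ι_mul, map_add, hx, h]
    abel

/-- A quadratic expression in derivations is a derivation when its polarization vanishes on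
pairs of generators. -/
theorem sum_exteriorDerivation_mul {I : Type*} [Fintype I] (f g : I → W →ₗ[ℂ] W)
    (h : W →ₗ[ℂ] W) (hh : ∀ w, ∑ i, f i (g i w) = h w)
    (hfg : ∀ v w, ∑ i, ExteriorAlgebra.ι ℂ (f i v) * ExteriorAlgebra.ι ℂ (g i w) = 0)
    (hgf : ∀ v w, ∑ i, ExteriorAlgebra.ι ℂ (g i v) * ExteriorAlgebra.ι ℂ (f i w) = 0)
    (x : ExteriorAlgebra ℂ W) :
    ∑ i, exteriorDerivation (f i) (exteriorDerivation (g i) x) = exteriorDerivation h x := by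
  -- These are the mixed terms of the Leibniz rule applied twice. Anticommuting f i v past each
  -- generator of x reduces them to pairs of generators.
  have cross (f g : I → W →ₗ[ℂ] W)
      (hfg : ∀ v w, ∑ i, ExteriorAlgebra.ι ℂ (f i v) * ExteriorAlgebra.ι ℂ (g i w) = 0)
      (v : W) (x : ExteriorAlgebra ℂ W) :
      ∑ i, ExteriorAlgebra.ι ℂ (f i v) * exteriorDerivation (g i) x = 0 := by
    induction x using ExteriorAlgebra.left_induction with
    | algebraMap c => simp
    | add x y hx hy => simp only [map_add, mul_add, Finset.sum_add_distrib, hx, hy, add_zero]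
    | ι_mul x w hx =>
      have e (i : I) : ExteriorAlgebra.ι ℂ (f i v) *
          (ExteriorAlgebra.ι ℂ w * exteriorDerivation (g i) x) =
          -(ExteriorAlgebra.ι ℂ w * (ExteriorAlgebra.ι ℂ (f i v) * exteriorDerivation (g i) x)) := by
        rw [← mul_assoc, eq_neg_of_add_eq_zero_left
          (ExteriorAlgebra.ι_add_mul_swap (R := ℂ) (f i v) w), neg_mul, mul_assoc]
      simp only [exteriorDerivation_ι_mul, mul_add, Finset.sum_add_distrib, e,
        Finset.sum_neg_distrib, ← Finset.mul_sum, hx]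
      simp only [← mul_assoc, ← Finset.sum_mul, hfg]
      simp
  induction x using ExteriorAlgebra.left_induction with
  | algebraMap c => simp
  | add x y hx hy => simp only [map_add, Finset.sum_add_distrib, hx, hy]
  | ι_mul x w hx =>
    simp only [exteriorDerivation_ι_mul, map_add, Finset.sum_add_distrib, cross f g hfg,
      cross g f hgf, ← Finset.mul_sum, ← Finset.sum_mul, hx, add_zero, zero_add, ← map_sum, hh]

/-- The derivation extending the identity is the degree operator. Every element is a scalar plus a
sum of eigenvectors of positive degree, and eigenspaces are independent. -/
theorem mem_span_one_of_exteriorDerivation_id {x : ExteriorAlgebra ℂ W}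
    (hx : exteriorDerivation LinearMap.id x = 0) :
    x ∈ Submodule.span ℂ {(1 : ExteriorAlgebra ℂ W)} := by
  set D : Module.End ℂ (ExteriorAlgebra ℂ W) := exteriorDerivation LinearMap.id with hD
  let P : Submodule ℂ (ExteriorAlgebra ℂ W) := ⨆ (k : ℂ) (_ : k ≠ 0), D.eigenspace k
  let Q : Submodule ℂ (ExteriorAlgebra ℂ W) := ⨆ n : ℕ, D.eigenspace ((n : ℂ) + 1)
  have hQP : Q ≤ P := iSup_le fun n =>
    le_iSup₂_of_le (f := fun (k : ℂ) (_ : k ≠ 0) => D.eigenspace k) ((n : ℂ) + 1)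
      (Nat.cast_add_one_ne_zero n) le_rfl
  have hmul (w : W) {n : ℂ} {y : ExteriorAlgebra ℂ W} (hy : y ∈ D.eigenspace n) :
      ExteriorAlgebra.ι ℂ w * y ∈ D.eigenspace (n + 1) := by
    rw [Module.End.mem_eigenspace_iff] at hy ⊢
    rw [hD, exteriorDerivation_ι_mul, ← hD, hy, LinearMap.id_apply, mul_smul_comm, add_smul,
      one_smul, add_comm]
  have hQmul (w : W) {y : ExteriorAlgebra ℂ W} (hy : y ∈ Q) : ExteriorAlgebra.ι ℂ w * y ∈ Q := by
    induction hy using Submodule.iSup_induction' with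
    | mem n y hy =>
      refine Submodule.mem_iSup_of_mem (n + 1) ?_
      simpa using hmul w hy
    | zero => simp
    | add y z _ _ hy hz => rw [mul_add]; exact Q.add_mem hy hz
  have key (y : ExteriorAlgebra ℂ W) : ∃ c : ℂ, y - algebraMap ℂ _ c ∈ Q := by
    induction y using ExteriorAlgebra.left_induction with
    | algebraMap c => exact ⟨c, by simp⟩
    | add y z hy hz =>
      obtain ⟨c, hc⟩ := hy
      obtain ⟨d, hd⟩ := hz
      refine ⟨c + d, ?_⟩
      rw [map_add, add_sub_add_comm]
      exact Q.add_mem hc hd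
    | ι_mul y w hy =>
      obtain ⟨c, hc⟩ := hy
      refine ⟨0, ?_⟩
      rw [map_zero, sub_zero, ← sub_add_cancel y (algebraMap ℂ _ c), mul_add]
      refine Q.add_mem (hQmul w hc) (Submodule.mem_iSup_of_mem 0 ?_)
      have : algebraMap ℂ _ c ∈ D.eigenspace 0 := by
        rw [Module.End.mem_eigenspace_iff, hD, exteriorDerivation_algebraMap, zero_smul]
      simpa using hmul w this
  obtain ⟨c, hc⟩ := key x
  have h0 : x - algebraMap ℂ _ c ∈ D.eigenspace 0 := by
    rw [Module.End.mem_eigenspace_iff, map_sub, hx, hD, exteriorDerivation_algebraMap]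
    simp
  have := (Module.End.eigenspaces_iSupIndep D 0).le_bot ⟨h0, hQP hc⟩
  rw [Submodule.mem_bot, sub_eq_zero] at this
  rw [this, Algebra.algebraMap_eq_smul_one]
  exact Submodule.smul_mem _ _ (Submodule.mem_span_singleton_self _)

/-- The derivative at the identity of the functorial action on `Λ(W)` is the derivation extending
the derivative of the curve of endomorphisms. -/
theorem hasDerivAt_exteriorAlgebra_map {K : Type*} [Fintype K] (c : K → ℂ → ℂ) (c' : K → ℂ)
    (F : K → W →ₗ[ℂ] W) (hc : ∀ k, HasDerivAt (c k) (c' k) 0)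
    (h0 : ∑ k, c k 0 • F k = LinearMap.id) (x : ExteriorAlgebra ℂ W)
    (φ : Module.Dual ℂ (ExteriorAlgebra ℂ W)) :
    HasDerivAt (fun t => φ (ExteriorAlgebra.map (∑ k, c k t • F k) x))
      (φ (exteriorDerivation (∑ k, c' k • F k) x)) 0 := by
  induction x using ExteriorAlgebra.left_induction generalizing φ with
  | algebraMap a => simpa using hasDerivAt_const (0 : ℂ) (φ (algebraMap ℂ _ a))
  | add x y hx hy =>
    simp only [map_add]
    exact (hx φ).add (hy φ)
  | ι_mul x w hx =>
    -- Left multiplication by a generator is absorbed into the functional, so the induction needs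
    -- only the scalar product rule.
    let ψ (k : K) : Module.Dual ℂ (ExteriorAlgebra ℂ W) :=
      φ ∘ₗ LinearMap.mulLeft ℂ (ExteriorAlgebra.ι ℂ (F k w))
    have h := HasDerivAt.fun_sum (u := Finset.univ) fun k _ => (hc k).mul (hx (ψ k))
    have e : ExteriorAlgebra.ι ℂ w = ∑ k, c k 0 • ExteriorAlgebra.ι ℂ (F k w) := by
      conv_lhs => rw [← LinearMap.id_apply (R := ℂ) w, ← h0]
      simp
    have e1 : φ (exteriorDerivation (∑ k, c' k • F k) (ExteriorAlgebra.ι ℂ w * x)) =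
        ∑ k, (c' k * ψ k (ExteriorAlgebra.map (∑ k, c k 0 • F k) x) +
          c k 0 * ψ k (exteriorDerivation (∑ k, c' k • F k) x)) := by
      rw [exteriorDerivation_ι_mul, e, h0, ExteriorAlgebra.map_id]
      simp [ψ, Finset.sum_mul, Finset.sum_add_distrib]
    have e2 (t : ℂ) : φ (ExteriorAlgebra.map (∑ k, c k t • F k) (ExteriorAlgebra.ι ℂ w * x)) =
        ∑ k, c k t * ψ k (ExteriorAlgebra.map (∑ k, c k t • F k) x) := by
      rw [map_mul, ExteriorAlgebra.map_apply_ι]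
      simp [ψ, Finset.sum_mul]
    simp only [e2, e1]
    exact h

/-- Each linear functional is constant along the orbit curve near 0, so its derivative there
vanishes; functionals separate points. -/
theorem exteriorDerivation_eq_zero_of_eventually_fixed {K : Type*} [Fintype K] (c : K → ℂ → ℂ)
    (c' : K → ℂ) (F : K → W →ₗ[ℂ] W) (hc : ∀ k, HasDerivAt (c k) (c' k) 0)
    (h0 : ∑ k, c k 0 • F k = LinearMap.id) {x : ExteriorAlgebra ℂ W}
    (hx : ∀ᶠ t in nhds 0, ExteriorAlgebra.map (∑ k, c k t • F k) x = x) :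
    exteriorDerivation (∑ k, c' k • F k) x = 0 := by
  rw [← Module.forall_dual_apply_eq_zero_iff ℂ]
  intro φ
  refine (hasDerivAt_exteriorAlgebra_map c c' F hc h0 x φ).unique ?_
  refine (hasDerivAt_const (0 : ℂ) (φ x)).congr_of_eventuallyEq ?_
  filter_upwards [hx] with t ht
  rw [ht]

end ExteriorDerivation

/-! ### Matrix units and the Casimir element on tensor squares -/

noncomputable section TensorSquareDerivation

variable {U : Type*} [AddCommGroup U] [Module ℂ U]

/-- The action `f ⊗ 1 + 1 ⊗ f` of an endomorphism `f` of `U`, as a Lie algebra element, on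
`U ⊗ U`. -/
def tensorLeibniz (f : U →ₗ[ℂ] U) : U ⊗[ℂ] U →ₗ[ℂ] U ⊗[ℂ] U :=
  TensorProduct.map f LinearMap.id + TensorProduct.map LinearMap.id f

@[simp]
theorem tensorLeibniz_tmul (f : U →ₗ[ℂ] U) (u v : U) :
    tensorLeibniz f (u ⊗ₜ v) = f u ⊗ₜ v + u ⊗ₜ f v := by
  simp [tensorLeibniz]

theorem comm_tensorLeibniz (f : U →ₗ[ℂ] U) (t : U ⊗[ℂ] U) :
    TensorProduct.comm ℂ U U (tensorLeibniz f t) =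
      tensorLeibniz f (TensorProduct.comm ℂ U U t) := by
  induction t with
  | zero => simp
  | add x y hx hy => simp only [map_add, hx, hy]
  | tmul x y => simp [add_comm]

theorem comm_map_self (f : U →ₗ[ℂ] U) (t : U ⊗[ℂ] U) :
    TensorProduct.comm ℂ U U (TensorProduct.map f f t) =
      TensorProduct.map f f (TensorProduct.comm ℂ U U t) := by
  induction t with
  | zero => simp
  | add x y hx hy => simp only [map_add, hx, hy]
  | tmul x y => simp

theorem Fintype.sum_prod_swap {I N : Type*} [Fintype I] [AddCommMonoid N] (f : I × I → N) :
    ∑ p : I × I, f p.swap = ∑ p, f p :=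
  (Equiv.prodComm I I).sum_comp f

/-- A family of endomorphisms `F i j` of `U` that satisfies the relations of the matrix units in
a standard or dual standard representation of `gl_n`. -/
structure IsMatrixUnitAction {I : Type*} [Fintype I] (F : I × I → U →ₗ[ℂ] U) : Prop where
  sum_tmul (u v : U) : ∑ p, F p u ⊗ₜ[ℂ] F p.swap v = v ⊗ₜ u
  sum_mul (u : U) : ∑ p, F p (F p.swap u) = (Fintype.card I : ℂ) • u

namespace IsMatrixUnitAction

variable {I : Type*} [Fintype I] {F : I × I → U →ₗ[ℂ] U}

theorem sum_tmul' (hF : IsMatrixUnitAction F) (u v : U) :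
    ∑ p, F p.swap u ⊗ₜ[ℂ] F p v = v ⊗ₜ u := by
  rw [← hF.sum_tmul u v, ← Fintype.sum_prod_swap]
  simp only [Prod.swap_swap]

theorem sum_bilin (hF : IsMatrixUnitAction F) {N : Type*} [AddCommGroup N] [Module ℂ N]
    (B : U →ₗ[ℂ] U →ₗ[ℂ] N) (u v : U) : ∑ p, B (F p u) (F p.swap v) = B v u := by
  simpa using congrArg (TensorProduct.lift B) (hF.sum_tmul u v)

/-- Both operators hitting the same factor gives n = `Fintype.card I`, once per factor; hitting
different factors gives the flip, in two ways. -/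
theorem sum_tensorLeibniz_mul (hF : IsMatrixUnitAction F) (t : U ⊗[ℂ] U) :
    ∑ p, tensorLeibniz (F p) (tensorLeibniz (F p.swap) t) =
      (2 * Fintype.card I : ℂ) • t + (2 : ℂ) • TensorProduct.comm ℂ U U t := by
  induction t with
  | zero => simp
  | add x y hx hy =>
    simp only [map_add, Finset.sum_add_distrib, hx, hy, smul_add]
    abel
  | tmul u v =>
    simp only [tensorLeibniz_tmul, map_add, Finset.sum_add_distrib, hF.sum_tmul, hF.sum_tmul',
      ← TensorProduct.sum_tmul, ← TensorProduct.tmul_sum, hF.sum_mul, TensorProduct.comm_tmul,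
      TensorProduct.tmul_smul, ← TensorProduct.smul_tmul']
    module

/-- For pure tensors, each of the four terms exchanges one factor of s with one factor of t. The
terms cancel in pairs by anticommutativity; ε enters only through ε² = 1, so both symmetry types
work. -/
theorem sum_tensorLeibniz_mul_tensorLeibniz (hF : IsMatrixUnitAction F) {R : Type*} [Ring R]
    [Algebra ℂ R] (J : U ⊗[ℂ] U →ₗ[ℂ] R) {ε : ℂ} (hε : ε * ε = 1)
    (hJ : ∀ u v, J (v ⊗ₜ u) = ε • J (u ⊗ₜ v)) (hJJ : ∀ s t, J s * J t + J t * J s = 0)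
    (s t : U ⊗[ℂ] U) :
    ∑ p, J (tensorLeibniz (F p) s) * J (tensorLeibniz (F p.swap) t) = 0 := by
  induction s with
  | zero => simp
  | add x y hx hy => simp only [map_add, add_mul, Finset.sum_add_distrib, hx, hy, add_zero]
  | tmul a b =>
  induction t with
  | zero => simp
  | add x y hx hy => simp only [map_add, mul_add, Finset.sum_add_distrib, hx, hy, add_zero]
  | tmul c d =>
    let L (v : U) : U →ₗ[ℂ] R := J ∘ₗ TensorProduct.mk ℂ U U v
    let M (v : U) : U →ₗ[ℂ] R := J ∘ₗ (TensorProduct.mk ℂ U U).flip v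
    have h1 := hF.sum_bilin ((LinearMap.mul ℂ R).compl₁₂ (M b) (M d)) a c
    have h2 := hF.sum_bilin ((LinearMap.mul ℂ R).compl₁₂ (M b) (L c)) a d
    have h3 := hF.sum_bilin ((LinearMap.mul ℂ R).compl₁₂ (L a) (M d)) b c
    have h4 := hF.sum_bilin ((LinearMap.mul ℂ R).compl₁₂ (L a) (L c)) b d
    simp only [L, M, LinearMap.compl₁₂_apply, LinearMap.mul_apply', LinearMap.comp_apply,
      LinearMap.flip_apply, TensorProduct.mk_apply] at h1 h2 h3 h4
    simp only [tensorLeibniz_tmul, map_add, add_mul, mul_add, Finset.sum_add_distrib, h1, h2, h3,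
      h4]
    have e : J (d ⊗ₜ b) * J (c ⊗ₜ a) = J (b ⊗ₜ d) * J (a ⊗ₜ c) := by
      rw [hJ b d, hJ a c, smul_mul_smul_comm, hε, one_smul]
    rw [e]
    have e1 := hJJ (c ⊗ₜ b) (a ⊗ₜ d)
    have e2 := hJJ (b ⊗ₜ d) (a ⊗ₜ c)
    rw [← add_zero (0 : R)]
    nth_rewrite 1 [← e1]
    rw [← e2]
    abel

end IsMatrixUnitAction

/-- The matrix unit attached to a pair of indices, for a basis. -/
def matrixUnit {I : Type*} (b : Module.Basis I ℂ U) (p : I × I) : U →ₗ[ℂ] U :=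
  (b.coord p.2).smulRight (b p.1)

theorem matrixUnit_apply {I : Type*} (b : Module.Basis I ℂ U) (p : I × I) (u : U) :
    matrixUnit b p u = b.repr u p.2 • b p.1 := rfl

/-- The scalar is the Kronecker delta, covering idempotent and square-zero units together. Such a
relation makes (1 + t f)⁻¹ explicit. -/
theorem matrixUnit_mul_self {I : Type*} (b : Module.Basis I ℂ U) (p : I × I) :
    matrixUnit b p * matrixUnit b p = b.repr (b p.1) p.2 • matrixUnit b p := by
  ext u
  simp only [Module.End.mul_apply, LinearMap.smul_apply, matrixUnit_apply, map_smul, smul_smul,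
    mul_comm]

theorem matrixUnit_isMatrixUnitAction {I : Type*} [Fintype I] (b : Module.Basis I ℂ U) :
    IsMatrixUnitAction (matrixUnit b) where
  sum_tmul u v := by
    conv_rhs => rw [← b.sum_repr u, ← b.sum_repr v]
    simp only [matrixUnit_apply, Fintype.sum_prod_type, Prod.fst_swap, Prod.snd_swap,
      TensorProduct.sum_tmul, TensorProduct.tmul_sum, TensorProduct.tmul_smul,
      ← TensorProduct.smul_tmul', smul_smul, Finset.smul_sum, mul_comm]
    rw [Finset.sum_comm]
  sum_mul u := by
    classical
    conv_rhs => rw [← b.sum_repr u]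
    simp [matrixUnit_apply, Fintype.sum_prod_type, ← Finset.smul_sum, Nat.cast_smul_eq_nsmul]

/-- In the dual basis this family is -E_ji, and both relations are stable under a global sign and
under swapping indices. -/
theorem neg_transpose_matrixUnit_isMatrixUnitAction {I : Type*} [Fintype I]
    (b : Module.Basis I ℂ U) :
    IsMatrixUnitAction fun p => -Module.Dual.transpose (R := ℂ) (matrixUnit b p) := by
  classical
  have e (p : I × I) (φ : Module.Dual ℂ U) :
      Module.Dual.transpose (R := ℂ) (matrixUnit b p) φ = φ (b p.1) • b.coord p.2 := by
    ext u
    simp [Module.Dual.transpose_apply, matrixUnit_apply, mul_comm]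
  have r (φ : Module.Dual ℂ U) : ∑ i, φ (b i) • b.coord i = φ :=
    b.sum_dual_apply_smul_coord φ
  constructor
  · intro u v
    conv_rhs => rw [← r u, ← r v]
    simp only [LinearMap.neg_apply, e, Fintype.sum_prod_type, Prod.fst_swap, Prod.snd_swap,
      TensorProduct.neg_tmul, TensorProduct.tmul_neg, smul_neg, neg_neg,
      TensorProduct.sum_tmul, TensorProduct.tmul_sum, TensorProduct.tmul_smul,
      ← TensorProduct.smul_tmul', Finset.smul_sum]
    simp only [smul_smul, mul_comm]
  · intro u
    conv_rhs => rw [← r u]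
    simp [e, Fintype.sum_prod_type_right, ← Finset.smul_sum, Nat.cast_smul_eq_nsmul]

section Signed

variable {S : Submodule ℂ (U ⊗[ℂ] U)} {ε : ℂ}

theorem tensorLeibniz_mem (hS : ∀ t, t ∈ S ↔ TensorProduct.comm ℂ U U t = ε • t)
    (f : U →ₗ[ℂ] U) : ∀ t ∈ S, tensorLeibniz f t ∈ S := fun t ht => by
  rw [hS] at ht ⊢
  rw [comm_tensorLeibniz, ht, map_smul]

theorem map_self_mem (hS : ∀ t, t ∈ S ↔ TensorProduct.comm ℂ U U t = ε • t)
    (f : U →ₗ[ℂ] U) : ∀ t ∈ S, TensorProduct.map f f t ∈ S := fun t ht => by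
  rw [hS] at ht ⊢
  rw [comm_map_self, ht, map_smul]

variable {I : Type*} [Fintype I] {F : I × I → U →ₗ[ℂ] U}

theorem IsMatrixUnitAction.sum_restrict_mul (hF : IsMatrixUnitAction F)
    (hS : ∀ t, t ∈ S ↔ TensorProduct.comm ℂ U U t = ε • t) (x : S) :
    ∑ p, (tensorLeibniz (F p)).restrict (tensorLeibniz_mem hS (F p))
      ((tensorLeibniz (F p.swap)).restrict (tensorLeibniz_mem hS (F p.swap)) x) =
      (2 * Fintype.card I + 2 * ε : ℂ) • x := by
  apply Subtype.ext
  have h := hF.sum_tensorLeibniz_mul x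
  rw [(hS x).1 x.2, smul_smul, ← add_smul] at h
  rw [Submodule.coe_smul, ← h, Submodule.coe_sum]
  rfl

theorem IsMatrixUnitAction.sum_restrict_mul_restrict (hF : IsMatrixUnitAction F)
    (hS : ∀ t, t ∈ S ↔ TensorProduct.comm ℂ U U t = ε • t) (hε : ε * ε = 1)
    {R : Type*} [Ring R] [Algebra ℂ R] (j : S →ₗ[ℂ] R) (hj : ∀ x y, j x * j y + j y * j x = 0)
    (x y : S) :
    ∑ p, j ((tensorLeibniz (F p)).restrict (tensorLeibniz_mem hS (F p)) x) *
      j ((tensorLeibniz (F p.swap)).restrict (tensorLeibniz_mem hS (F p.swap)) y) = 0 := by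
  -- The ε-symmetrizer, which is multiplication by 2 on S, extends j to all of U ⊗ U; the resulting
  -- factor 4 is cancelled at the end.
  let q : U ⊗[ℂ] U →ₗ[ℂ] S :=
    (LinearMap.id + ε • (TensorProduct.comm ℂ U U).toLinearMap).codRestrict S fun t => by
      rw [hS]
      simp [smul_smul, hε, add_comm]
  have hq (t : U ⊗[ℂ] U) : (q t : U ⊗[ℂ] U) = t + ε • TensorProduct.comm ℂ U U t := rfl
  have hq2 (x : S) : q x = (2 : ℂ) • x := by
    apply Subtype.ext
    rw [hq, (hS x).1 x.2, smul_smul, hε, one_smul, two_smul]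
    rfl
  have hqL (f : U →ₗ[ℂ] U) (x : S) : q (tensorLeibniz f x) =
      (2 : ℂ) • (tensorLeibniz f).restrict (tensorLeibniz_mem hS f) x := by
    rw [← hq2]
    rfl
  have h := hF.sum_tensorLeibniz_mul_tensorLeibniz (j ∘ₗ q) hε (fun u v => by
    rw [LinearMap.comp_apply, LinearMap.comp_apply, ← map_smul]
    congr 1
    apply Subtype.ext
    rw [Submodule.coe_smul, hq, hq]
    simp [smul_smul, hε, add_comm]) (fun s t => hj _ _) x y
  simp only [LinearMap.comp_apply, hqL, map_smul, smul_mul_smul_comm, ← Finset.smul_sum] at h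
  exact (smul_eq_zero.1 h).resolve_left (by norm_num)

end Signed

end TensorSquareDerivation

/-! ### From `GL(V)`-invariance to vanishing degree -/

noncomputable section Invariants

theorem tensorLeibniz_neg {U : Type*} [AddCommGroup U] [Module ℂ U] (f : U →ₗ[ℂ] U) :
    tensorLeibniz (-f) = -tensorLeibniz f := by
  ext u v
  simp [TensorProduct.neg_tmul, TensorProduct.tmul_neg, add_comm]

theorem map_add_smul_self_apply {U : Type*} [AddCommGroup U] [Module ℂ U] (f : U →ₗ[ℂ] U) (c : ℂ)
    (t : U ⊗[ℂ] U) :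
    TensorProduct.map (LinearMap.id + c • f) (LinearMap.id + c • f) t =
      t + c • tensorLeibniz f t + c ^ 2 • TensorProduct.map f f t := by
  induction t with
  | zero => simp
  | add x y hx hy =>
    simp only [map_add, hx, hy]
    module
  | tmul u v =>
    simp only [TensorProduct.map_tmul, LinearMap.add_apply, LinearMap.id_apply,
      LinearMap.smul_apply, tensorLeibniz_tmul, TensorProduct.add_tmul, TensorProduct.tmul_add,
      TensorProduct.tmul_smul, ← TensorProduct.smul_tmul']
    module

section Casimir

variable {U W : Type*} [AddCommGroup U] [Module ℂ U] [AddCommGroup W] [Module ℂ W]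
  {S : Submodule ℂ (U ⊗[ℂ] U)} {ε : ℂ} {I : Type*} [Fintype I]

/-- The endomorphism of `W` induced by an endomorphism of `U` acting, as a Lie algebra element, on
a direct summand `S` of `W` that consists of the (anti)symmetric tensors over `U`. -/
def summandAction (hS : ∀ t, t ∈ S ↔ TensorProduct.comm ℂ U U t = ε • t) (i : S →ₗ[ℂ] W)
    (r : W →ₗ[ℂ] S) (f : U →ₗ[ℂ] U) : W →ₗ[ℂ] W :=
  i ∘ₗ (tensorLeibniz f).restrict (tensorLeibniz_mem hS f) ∘ₗ r

theorem IsMatrixUnitAction.casimir {F : I × I → U →ₗ[ℂ] U} (hF : IsMatrixUnitAction F)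
    (hS : ∀ t, t ∈ S ↔ TensorProduct.comm ℂ U U t = ε • t) (hε : ε * ε = 1)
    (i : S →ₗ[ℂ] W) (r : W →ₗ[ℂ] S) (hri : ∀ x, r (i x) = x) (x : ExteriorAlgebra ℂ W) :
    ∑ p, exteriorDerivation (summandAction hS i r (F p))
        (exteriorDerivation (summandAction hS i r (F p.swap)) x) =
      (2 * Fintype.card I + 2 * ε : ℂ) • exteriorDerivation (i ∘ₗ r) x := by
  have hfg (v w : W) : ∑ p, ExteriorAlgebra.ι ℂ (summandAction hS i r (F p) v) *
      ExteriorAlgebra.ι ℂ (summandAction hS i r (F p.swap) w) = 0 :=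
    hF.sum_restrict_mul_restrict hS hε (ExteriorAlgebra.ι ℂ ∘ₗ i)
      (fun x y => ExteriorAlgebra.ι_add_mul_swap _ _) (r v) (r w)
  rw [← LinearMap.smul_apply, ← exteriorDerivation_smul]
  refine sum_exteriorDerivation_mul _ _ _ (fun w => ?_) hfg (fun v w => ?_) x
  · have h := congrArg i (hF.sum_restrict_mul hS (r w))
    rw [map_sum, map_smul] at h
    simpa only [summandAction, LinearMap.comp_apply, LinearMap.smul_apply, hri] using h
  · rw [← hfg v w, ← Fintype.sum_prod_swap]
    simp only [Prod.swap_swap]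

end Casimir

variable (V : Type*) [AddCommGroup V] [Module ℂ V]

theorem mem_antisymTensors_iff (t : V ⊗[ℂ] V) :
    t ∈ antisymTensors V ↔ TensorProduct.comm ℂ V V t = (-1 : ℂ) • t := by
  rw [neg_one_smul]
  rfl

theorem mem_symTensors_iff (t : V ⊗[ℂ] V) :
    t ∈ symTensors V ↔ TensorProduct.comm ℂ V V t = (1 : ℂ) • t := by
  rw [one_smul]
  rfl

variable {V}

/-- `W` is the direct sum of `A` and `B`, with inclusions `i`, `i'` and projections `r`, `r'`. -/
structure IsBinaryDirectSum {A B W : Type*} [AddCommMonoid A] [Module ℂ A] [AddCommMonoid B]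
    [Module ℂ B] [AddCommMonoid W] [Module ℂ W] (i : A →ₗ[ℂ] W) (r : W →ₗ[ℂ] A) (i' : B →ₗ[ℂ] W)
    (r' : W →ₗ[ℂ] B) : Prop where
  fst_inl (x : A) : r (i x) = x
  snd_inr (x : B) : r' (i' x) = x
  fst_inr (x : B) : r (i' x) = 0
  snd_inl (x : A) : r' (i x) = 0
  total (x : W) : i (r x) + i' (r' x) = x

section DirectSum

variable {W : Type*} [AddCommGroup W] [Module ℂ W]
  {i : antisymTensors V →ₗ[ℂ] W} {r : W →ₗ[ℂ] antisymTensors V}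
  {i' : symTensors (Module.Dual ℂ V) →ₗ[ℂ] W} {r' : W →ₗ[ℂ] symTensors (Module.Dual ℂ V)}

variable (i r) in
/-- The Lie algebra action of an endomorphism of `V` on the summand `Λ₂(V)`. -/
def antisymAction (f : V →ₗ[ℂ] V) : W →ₗ[ℂ] W :=
  summandAction (mem_antisymTensors_iff V) i r f

variable (i' r') in
/-- The Lie algebra action of an endomorphism of `V*` on the summand `S₂(V*)`. -/
def symDualAction (f : Module.Dual ℂ V →ₗ[ℂ] Module.Dual ℂ V) : W →ₗ[ℂ] W :=
  summandAction (mem_symTensors_iff (Module.Dual ℂ V)) i' r' f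

variable (i' r') in
theorem symDualAction_neg (f : Module.Dual ℂ V →ₗ[ℂ] Module.Dual ℂ V) :
    symDualAction i' r' (-f) = -symDualAction i' r' f := by
  refine LinearMap.ext fun x => ?_
  refine Eq.trans (congrArg i' (Subtype.ext ?_)) (map_neg i' _)
  change tensorLeibniz (-f) (r' x : Module.Dual ℂ V ⊗[ℂ] Module.Dual ℂ V) =
    -tensorLeibniz f (r' x)
  rw [tensorLeibniz_neg, LinearMap.neg_apply]

theorem antisymRep_apply_of_eq (g : LinearMap.GeneralLinearGroup ℂ V) (f : V →ₗ[ℂ] V)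
    (c : ℂ) (h : (g : V →ₗ[ℂ] V) = LinearMap.id + c • f) (x : antisymTensors V) :
    antisymRep (stdRep V) g x =
      x + c • (tensorLeibniz f).restrict (tensorLeibniz_mem (mem_antisymTensors_iff V) f) x +
      c ^ 2 • (TensorProduct.map f f).restrict (map_self_mem (mem_antisymTensors_iff V) f) x := by
  apply Subtype.ext
  change TensorProduct.map (g : V →ₗ[ℂ] V) (g : V →ₗ[ℂ] V) (x : V ⊗[ℂ] V) =
    (x : V ⊗[ℂ] V) + c • tensorLeibniz f (x : V ⊗[ℂ] V) +
      c ^ 2 • TensorProduct.map f f (x : V ⊗[ℂ] V)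
  rw [h, map_add_smul_self_apply]

theorem symRep_dual_apply_of_eq (g : LinearMap.GeneralLinearGroup ℂ V) (f : V →ₗ[ℂ] V)
    (d : ℂ) (h : ((g⁻¹ : LinearMap.GeneralLinearGroup ℂ V) : V →ₗ[ℂ] V) = LinearMap.id + d • f)
    (x : symTensors (Module.Dual ℂ V)) :
    symRep (stdRep V).dual g x =
      x + d • (tensorLeibniz (Module.Dual.transpose (R := ℂ) f)).restrict
        (tensorLeibniz_mem (mem_symTensors_iff (Module.Dual ℂ V)) _) x +
      d ^ 2 • (TensorProduct.map (Module.Dual.transpose (R := ℂ) f)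
          (Module.Dual.transpose (R := ℂ) f)).restrict
        (map_self_mem (mem_symTensors_iff (Module.Dual ℂ V)) _) x := by
  apply Subtype.ext
  set f' := Module.Dual.transpose (R := ℂ) f
  have e : Module.Dual.transpose (R := ℂ)
      ((g⁻¹ : LinearMap.GeneralLinearGroup ℂ V) : V →ₗ[ℂ] V) = LinearMap.id + d • f' := by
    rw [h, map_add, map_smul]
    rfl
  change TensorProduct.map
      (Module.Dual.transpose (R := ℂ) ((g⁻¹ : LinearMap.GeneralLinearGroup ℂ V) : V →ₗ[ℂ] V))
      (Module.Dual.transpose (R := ℂ) ((g⁻¹ : LinearMap.GeneralLinearGroup ℂ V) : V →ₗ[ℂ] V))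
      (x : Module.Dual ℂ V ⊗[ℂ] Module.Dual ℂ V) =
    (x : Module.Dual ℂ V ⊗[ℂ] Module.Dual ℂ V) +
      d • tensorLeibniz f' (x : Module.Dual ℂ V ⊗[ℂ] Module.Dual ℂ V) +
      d ^ 2 • TensorProduct.map f' f' (x : Module.Dual ℂ V ⊗[ℂ] Module.Dual ℂ V)
  rw [e, map_add_smul_self_apply]

variable {ρ : Representation ℂ (LinearMap.GeneralLinearGroup ℂ V) W}

/-- The invariants of `GL(V)` are killed by the elements of its Lie algebra that square to a
multiple of themselves. -/
theorem exteriorDerivation_eq_zero_of_invariant (hs : IsBinaryDirectSum i r i' r')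
    (hρ : ∀ g w, ρ g w = i (antisymRep (stdRep V) g (r w)) + i' (symRep (stdRep V).dual g (r' w)))
    {f : V →ₗ[ℂ] V} {δ : ℂ} (hf : f * f = δ • f) {x : ExteriorAlgebra ℂ W}
    (hx : ∀ g, ExteriorAlgebra.map (ρ g) x = x) :
    exteriorDerivation
      (antisymAction i r f + symDualAction i' r' (-Module.Dual.transpose (R := ℂ) f)) x = 0 := by
  -- Since f² = δ f, the inverse of 1 + t f is 1 + s f exactly when t + s + δ t s = 0. The
  -- contragredient action uses this inverse.
  let s : ℂ → ℂ := fun t => -t / (1 + δ * t)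
  have hsd : HasDerivAt s (-1) 0 := by
    have h : HasDerivAt s _ 0 := (hasDerivAt_id (0 : ℂ)).neg.div
      (((hasDerivAt_id (0 : ℂ)).const_mul δ).const_add 1) (by simp)
    convert h using 1
    simp
  have hs0 : s 0 = 0 := by simp [s]
  -- Expanding g ⊗ g on both summands writes the action of g = 1 + t f as a combination of five
  -- fixed operators; only the two linear ones have coefficients with nonzero derivative at 0.
  let F : Fin 5 → W →ₗ[ℂ] W :=
    ![LinearMap.id, antisymAction i r f,
      i ∘ₗ (TensorProduct.map f f).restrict (map_self_mem (mem_antisymTensors_iff V) f) ∘ₗ r,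
      symDualAction i' r' (Module.Dual.transpose (R := ℂ) f),
      i' ∘ₗ (TensorProduct.map (Module.Dual.transpose (R := ℂ) f)
          (Module.Dual.transpose (R := ℂ) f)).restrict
        (map_self_mem (mem_symTensors_iff (Module.Dual ℂ V)) _) ∘ₗ r']
  let c : Fin 5 → ℂ → ℂ := ![fun _ => 1, fun t => t, fun t => t ^ 2, s, fun t => s t ^ 2]
  have hsq {u : ℂ → ℂ} {u' : ℂ} (hu : HasDerivAt u u' 0) (hu0 : u 0 = 0) :
      HasDerivAt (fun t => u t ^ 2) 0 0 := by
    have h : HasDerivAt (fun t => u t ^ 2) _ 0 := hu.pow 2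
    convert h using 1
    simp [hu0]
  have hc (k : Fin 5) : HasDerivAt (c k) (![0, 1, 0, -1, 0] k) 0 := by
    fin_cases k
    · exact hasDerivAt_const _ _
    · exact hasDerivAt_id _
    · exact hsq (hasDerivAt_id _) rfl
    · exact hsd
    · exact hsq hsd hs0
  have h := exteriorDerivation_eq_zero_of_eventually_fixed c _ F hc (x := x)
    (by simp [Fin.sum_univ_five, c, F, hs0]) ?_
  · rw [symDualAction_neg]
    simpa [Fin.sum_univ_five, F, neg_one_smul] using h
  have hne : ∀ᶠ t : ℂ in nhds 0, 1 + δ * t ≠ 0 :=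
    (Continuous.continuousAt (by fun_prop)).eventually_ne (by simp)
  filter_upwards [hne] with t ht
  have hst : t + s t + t * s t * δ = 0 := by
    have : s t * (1 + δ * t) = -t := div_mul_cancel₀ _ ht
    linear_combination this
  have hmul (a b : ℂ) (hab : a + b + a * b * δ = 0) :
      ((LinearMap.id : V →ₗ[ℂ] V) + a • f) * (LinearMap.id + b • f) = 1 := by
    have : ((LinearMap.id : V →ₗ[ℂ] V) + a • f) * (LinearMap.id + b • f) =
        1 + (a + b + a * b * δ) • f := by
      change ((1 : V →ₗ[ℂ] V) + a • f) * (1 + b • f) = _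
      rw [mul_add, add_mul, add_mul, smul_mul_smul_comm, hf]
      simp only [one_mul, mul_one]
      module
    rw [this, hab, zero_smul, add_zero]
  let g : LinearMap.GeneralLinearGroup ℂ V :=
    ⟨LinearMap.id + t • f, LinearMap.id + s t • f, hmul _ _ hst,
      hmul _ _ (by rw [← hst]; ring)⟩
  have e : ∑ k, c k t • F k = ρ g := by
    refine LinearMap.ext fun w => ?_
    rw [hρ, antisymRep_apply_of_eq g f t rfl, symRep_dual_apply_of_eq g f (s t) rfl]
    simp only [map_add, map_smul]
    conv_lhs => simp only [Fin.sum_univ_five, LinearMap.add_apply, LinearMap.smul_apply]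
    change (1 : ℂ) • w + t • i _ + t ^ 2 • i _ + s t • i' _ + s t ^ 2 • i' _ = _
    nth_rewrite 1 [← hs.total w]
    rw [one_smul]
    abel
  rw [e]
  exact hx g

theorem tensorLeibniz_id {U : Type*} [AddCommGroup U] [Module ℂ U] (t : U ⊗[ℂ] U) :
    tensorLeibniz LinearMap.id t = (2 : ℂ) • t := by
  simp [tensorLeibniz, two_smul]

theorem antisymAction_id : antisymAction i r LinearMap.id = (2 : ℂ) • (i ∘ₗ r) := by
  refine LinearMap.ext fun x => ?_
  have h : (tensorLeibniz LinearMap.id).restrict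
      (tensorLeibniz_mem (mem_antisymTensors_iff V) LinearMap.id) (r x) = (2 : ℂ) • r x :=
    Subtype.ext (tensorLeibniz_id _)
  exact (congrArg i h).trans (map_smul i _ _)

theorem symDualAction_id : symDualAction i' r' LinearMap.id = (2 : ℂ) • (i' ∘ₗ r') := by
  refine LinearMap.ext fun x => ?_
  have h : (tensorLeibniz LinearMap.id).restrict
      (tensorLeibniz_mem (mem_symTensors_iff (Module.Dual ℂ V)) LinearMap.id) (r' x) =
      (2 : ℂ) • r' x :=
    Subtype.ext (tensorLeibniz_id _)
  exact (congrArg i' h).trans (map_smul i' _ _)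

theorem exteriorDerivation_id_eq_zero_of_invariant [FiniteDimensional ℂ V]
    (hs : IsBinaryDirectSum i r i' r')
    (hρ : ∀ g w, ρ g w = i (antisymRep (stdRep V) g (r w)) + i' (symRep (stdRep V).dual g (r' w)))
    {x : ExteriorAlgebra ℂ W} (hx : ∀ g, ExteriorAlgebra.map (ρ g) x = x) :
    exteriorDerivation LinearMap.id x = 0 := by
  let b := Module.finBasis ℂ V
  let n : ℂ := Fintype.card (Fin (Module.finrank ℂ V))
  let α p := antisymAction i r (matrixUnit b p)
  let β p := symDualAction i' r' (-Module.Dual.transpose (R := ℂ) (matrixUnit b p))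
  have hαβ p : exteriorDerivation (α p) x = -exteriorDerivation (β p) x := by
    rw [eq_neg_iff_add_eq_zero, ← LinearMap.add_apply, ← exteriorDerivation_add]
    exact exteriorDerivation_eq_zero_of_invariant hs hρ (matrixUnit_mul_self b p) hx
  have hcomm p q y : exteriorDerivation (α p) (exteriorDerivation (β q) y) =
      exteriorDerivation (β q) (exteriorDerivation (α p) y) := by
    refine exteriorDerivation_comm (fun w => ?_) y
    simp only [α, β, antisymAction, symDualAction, summandAction, LinearMap.comp_apply,
      hs.fst_inr, hs.snd_inl, map_zero]
  have hα : ∑ p, exteriorDerivation (α p) (exteriorDerivation (α p.swap) x) =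
      (2 * n + 2 * (-1)) • exteriorDerivation (i ∘ₗ r) x :=
    (matrixUnit_isMatrixUnitAction b).casimir (mem_antisymTensors_iff V) (by norm_num)
      i r hs.fst_inl x
  have hβ : ∑ p, exteriorDerivation (β p) (exteriorDerivation (β p.swap) x) =
      (2 * n + 2 * 1) • exteriorDerivation (i' ∘ₗ r') x :=
    (neg_transpose_matrixUnit_isMatrixUnitAction b).casimir
      (mem_symTensors_iff (Module.Dual ℂ V)) (by norm_num) i' r' hs.snd_inr x
  have hcas : (2 * n + 2 * (-1)) • exteriorDerivation (i ∘ₗ r) x =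
      (2 * n + 2 * 1) • exteriorDerivation (i' ∘ₗ r') x := by
    -- With q the swap of p, α_p α_q x = -α_p β_q x = -β_q α_p x = β_q β_p x. The order is reversed,
    -- hence the reindexing.
    rw [← hα, ← hβ, ← Fintype.sum_prod_swap fun p =>
      exteriorDerivation (β p) (exteriorDerivation (β p.swap) x)]
    refine Finset.sum_congr rfl fun p _ => ?_
    rw [hαβ, map_neg, hcomm, hαβ, map_neg, neg_neg, Prod.swap_swap]
  -- The identity of gl(V) acts by 2 on `Λ₂(V)` and by -2 on `S₂(V*)`, so an invariant has equal
  -- degrees in the two.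
  have hid : exteriorDerivation (i ∘ₗ r) x = exteriorDerivation (i' ∘ₗ r') x := by
    have h := exteriorDerivation_eq_zero_of_invariant hs hρ (f := LinearMap.id) (δ := 1)
      (by rw [one_smul]; rfl) hx
    have e : Module.Dual.transpose (R := ℂ) (LinearMap.id : V →ₗ[ℂ] V) = LinearMap.id := rfl
    rw [symDualAction_neg, e, antisymAction_id, symDualAction_id, ← smul_neg, ← smul_add,
      ← neg_one_smul ℂ, exteriorDerivation_smul, exteriorDerivation_add,
      exteriorDerivation_smul, LinearMap.smul_apply] at h
    have h' := (smul_eq_zero.1 h).resolve_left (by norm_num)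
    rwa [LinearMap.add_apply, LinearMap.smul_apply, neg_one_smul, ← sub_eq_add_neg,
      sub_eq_zero] at h'
  -- 4 = (2n + 2) - (2n - 2), nonzero whatever the dimension.
  have h4 : (4 : ℂ) • exteriorDerivation (i' ∘ₗ r') x = 0 := by
    rw [hid] at hcas
    have h := sub_eq_zero.2 hcas.symm
    rw [← sub_smul] at h
    convert h using 2
    ring
  have hB := (smul_eq_zero.1 h4).resolve_left (by norm_num)
  have e : LinearMap.id = i ∘ₗ r + i' ∘ₗ r' := LinearMap.ext fun w => (hs.total w).symm
  rw [e, exteriorDerivation_add, LinearMap.add_apply, hid, hB, add_zero]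

theorem exteriorInvariants_eq_span_one [FiniteDimensional ℂ V]
    (hs : IsBinaryDirectSum i r i' r')
    (hρ : ∀ g w, ρ g w =
      i (antisymRep (stdRep V) g (r w)) + i' (symRep (stdRep V).dual g (r' w))) :
    Subalgebra.toSubmodule (exteriorInvariants ρ) = Submodule.span ℂ {1} := by
  refine le_antisymm (fun x hx => ?_) ?_
  · exact mem_span_one_of_exteriorDerivation_id
      (exteriorDerivation_id_eq_zero_of_invariant hs hρ hx)
  · rw [Submodule.span_singleton_le_iff_mem]
    exact one_mem (exteriorInvariants ρ)

end DirectSum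

end Invariants

theorem theorem5p3 (V : Type*) [AddCommGroup V] [Module ℂ V] [FiniteDimensional ℂ V] :
    Subalgebra.toSubmodule
      (exteriorInvariants (G := LinearMap.GeneralLinearGroup ℂ V)
        (W := antisymTensors V × symTensors (Module.Dual ℂ V)) (antisymSymDualRep V)) =
      Submodule.span ℂ {1} := by
  have hs : IsBinaryDirectSum
      (LinearMap.inl ℂ (antisymTensors V) (symTensors (Module.Dual ℂ V)))
      (LinearMap.fst ℂ (antisymTensors V) (symTensors (Module.Dual ℂ V)))
      (LinearMap.inr ℂ (antisymTensors V) (symTensors (Module.Dual ℂ V)))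
      (LinearMap.snd ℂ (antisymTensors V) (symTensors (Module.Dual ℂ V))) :=
    ⟨fun _ => rfl, fun _ => rfl, fun _ => rfl, fun _ => rfl, fun x => by simp⟩
  have hρ (g : LinearMap.GeneralLinearGroup ℂ V)
      (w : antisymTensors V × symTensors (Module.Dual ℂ V)) : antisymSymDualRep V g w =
      LinearMap.inl ℂ (antisymTensors V) (symTensors (Module.Dual ℂ V))
        (antisymRep (stdRep V) g w.1) +
      LinearMap.inr ℂ (antisymTensors V) (symTensors (Module.Dual ℂ V))
        (symRep (stdRep V).dual g w.2) := by
    rw [LinearMap.inl_apply, LinearMap.inr_apply, Prod.mk_add_mk, add_zero, zero_add]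
    rfl
  exact exteriorInvariants_eq_span_one hs hρ
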